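/- Let $\Omega=\{(t_1,t_2)\in\mathbb R^2 : t_1<t_2\}$ be the open upper half-plane with the Euclidean distance $d$, let $\partial\Omega=\{(t,t): t\in\mathbb R\}$ be its boundary and $\overline\Omega=\Omega\cup\partial\Omega$. Let $1\le p<\infty$. For a Radon measure $\mu$ on $\Omega$ (a Borel measure giving finite mass to every compact subset of $\Omega$) put $\mathrm{Pers}_p(\mu)=\int_\Omega d(x,\partial\Omega)^p\,d\mu(x)$, and let $\mathcal M^p$ be the set of Radon measures $\mu$ on $\Omega$ with $\mathrm{Pers}_p(\mu)<\infty$. For $\mu,\nu\in\mathcal M^p$, let $\mathrm{Adm}(\mu,\nu)$ be the set of Borel measures $\pi$ on $\overline\Omega\times\overline\Omega$ that give finite mass to every compact subset of $E_\Omega=(\overline\Omega\times\overline\Omega)\setminus(\partial\Omega\times\partial\Omega)$ and satisfy $\pi(A\times\overline\Omega)=\mu(A)$ and $\pi(\overline\Omega\times B)=\nu(B)$ for all Borel sets $A,B\subset\Omega$, and let $$\mathrm{OT}_p(\mu,\nu)=\Big(\inf_{\pi\in\mathrm{Adm}(\mu,\nu)}\iint_{\overline\Omega\times\overline\Omega}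 d(x,y)^p\,d\pi(x,y)\Big)^{1/p}.$$ **Theorem.** Let $\mu,\mu_1,\mu_2,\dots$ be measures in $\mathcal M^p$. Then $\mathrm{OT}_p(\mu_n,\mu)\to 0$ as $n\to\infty$ if and only if both of the following hold: (i) $\mu_n$ converges vaguely to $\mu$, that is, $\int_\Omega f\,d\mu_n\to\int_\Omega f\,d\mu$ for every continuous compactly supported $f:\Omega\to\mathbb R$; (ii) $\mathrm{Pers}_p(\mu_n)\to\mathrm{Pers}_p(\mu)$. -/

import Mathlib

open MeasureTheory Filter Topology
open scoped ENNReal CompactlySupported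

namespace PersistenceMeasure

/-- The Euclidean plane. -/
abbrev Plane : Type := EuclideanSpace ℝ (Fin 2)

/-- The open upper half-plane `Ω = {(t₁, t₂) : t₁ < t₂}`. -/
def upperHalf : Set Plane := {x | x 0 < x 1}

/-- The diagonal `∂Ω = {(t, t)}`. -/
def diagonal : Set Plane := {x | x 0 = x 1}

/-- The closed half-plane `Ω ∪ ∂Ω`. -/
def closedHalf : Set Plane := upperHalf ∪ diagonal

/-- The inclusion of `Ω` into `Ω ∪ ∂Ω`. -/
def incl : upperHalf → closedHalf := Set.inclusion Set.subset_union_left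

/-- The set `E_Ω = (Ω ∪ ∂Ω)² \ (∂Ω × ∂Ω)`. -/
def offDiagonal : Set (closedHalf × closedHalf) :=
  {z | ¬ ((z.1 : Plane) ∈ diagonal ∧ (z.2 : Plane) ∈ diagonal)}

/-- The `p`-persistence `∫_Ω d(x, ∂Ω)^p dμ(x)` of a Borel measure on `Ω`. -/
noncomputable def Pers (p : ℝ) (μ : Measure upperHalf) : ℝ≥0∞ :=
  ∫⁻ x : upperHalf, Metric.infEDist (x : Plane) diagonal ^ p ∂μ

/-- The space `M^p` of Radon measures on `Ω` (Borel measures giving finite mass to every compact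
subset of `Ω`) with finite `p`-persistence. -/
def MeasuresWithFinitePers (p : ℝ) : Set (Measure upperHalf) :=
  {μ | IsFiniteMeasureOnCompacts μ ∧ Pers p μ < ∞}

/-- The admissible transport plans between `μ` and `ν`: Borel measures on `(Ω ∪ ∂Ω)²` that give
finite mass to every compact subset of `E_Ω` and whose marginals, restricted to `Ω`, are `μ`
and `ν`. The mass carried by `∂Ω × ∂Ω` is unconstrained. -/
structure IsAdmissible (μ ν : Measure upperHalf) (π : Measure (closedHalf × closedHalf)) :
    Prop where
  finite_on_compacts : ∀ K : Set (closedHalf × closedHalf),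
    IsCompact K → K ⊆ offDiagonal → π K < ∞
  fst_marginal : ∀ A : Set upperHalf, MeasurableSet A → π ((incl '' A) ×ˢ Set.univ) = μ A
  snd_marginal : ∀ B : Set upperHalf, MeasurableSet B → π (Set.univ ×ˢ (incl '' B)) = ν B

/-- The cost `∬ d(x, y)^p dπ(x, y)` of a transport plan. -/
noncomputable def cost (p : ℝ) (π : Measure (closedHalf × closedHalf)) : ℝ≥0∞ :=
  ∫⁻ z, edist z.1 z.2 ^ p ∂π

/-- The optimal transport distance with boundary. -/
noncomputable def OT (p : ℝ) (μ ν : Measure upperHalf) : ℝ≥0∞ :=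
  (⨅ (π : Measure (closedHalf × closedHalf)) (_ : IsAdmissible μ ν π), cost p π) ^ (1 / p)

/-- Vague convergence on `Ω`: convergence of the integrals of every continuous function on `Ω`
whose support is a compact subset of `Ω`. -/
def VaguelyTendsto (μs : ℕ → Measure upperHalf) (μ : Measure upperHalf) : Prop :=
  ∀ f : C_c(upperHalf, ℝ), Tendsto (fun n => ∫ x, f x ∂(μs n)) atTop (𝓝 (∫ x, f x ∂μ))

end PersistenceMeasure

namespace PersistenceMeasure

/-! Write d for the distance to the diagonal. If OT tends to 0, take nearly optimal plans π. As d is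
1-Lipschitz, Minkowski's inequality in L^p(π) compares the p-th roots of the persistences up to the
p-th root of the cost, giving (ii). A test function satisfies |F x - F y| ≤ ε (d(x)^p + d(y)^p) + C
|x - y|^p (`exists_abs_sub_le`); integrated against π, this gives (i).

Conversely, a compact set carries all but η of the persistence of μ. On it take a finite partition
of unity φ_i, each piece having diameter small relative to d. Match φ_i μ_n with φ_i μ by a multiple
of the product measure and project what remains onto the diagonal (`plan`). The matched part costs
at most η^p Pers(μ) (`cost_plan_le`). The remainders cost at most their persistence, whose limit is
at most η (`tendsto_pers_leftover`); vague convergence enters only through the functions φ_i and φ_i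
d^p. -/

/-! ### Geometry of the half-plane and the distance to the diagonal. -/

theorem continuous_coord (i : Fin 2) : Continuous fun x : Plane => x i := by fun_prop

theorem isOpen_upperHalf : IsOpen upperHalf :=
  isOpen_lt (continuous_coord 0) (continuous_coord 1)

theorem isClosed_diagonal : IsClosed diagonal :=
  isClosed_eq (continuous_coord 0) (continuous_coord 1)

theorem diagonal_nonempty : diagonal.Nonempty := ⟨0, by simp [diagonal]⟩

theorem not_mem_diagonal {x : Plane} (hx : x ∈ upperHalf) : x ∉ diagonal := fun h => by
  simp only [upperHalf, diagonal, Set.mem_ofPred_eq] at hx h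
  exact hx.ne h

instance : LocallyCompactSpace upperHalf := isOpen_upperHalf.locallyCompactSpace

theorem coe_incl (x : upperHalf) : ((incl x : closedHalf) : Plane) = x := rfl

theorem continuous_incl : Continuous incl := continuous_inclusion Set.subset_union_left

theorem measurable_incl : Measurable incl := continuous_incl.measurable

theorem incl_injective : Function.Injective incl := Set.inclusion_injective Set.subset_union_left

theorem range_incl : Set.range incl = {x : closedHalf | (x : Plane) ∈ upperHalf} :=
  Set.range_inclusion Set.subset_union_left

theorem mem_range_incl {x : closedHalf} : x ∈ Set.range incl ↔ (x : Plane) ∉ diagonal := by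
  rw [range_incl]
  exact ⟨not_mem_diagonal, fun h => x.2.resolve_right h⟩

theorem measurableSet_range_incl : MeasurableSet (Set.range incl) := by
  rw [range_incl]
  exact (isOpen_upperHalf.preimage continuous_subtype_val).measurableSet

theorem measurableEmbedding_incl : MeasurableEmbedding incl :=
  have h : IsEmbedding incl := .inclusion Set.subset_union_left
  h.measurableEmbedding measurableSet_range_incl

/-- The distance to the diagonal, as a function on the plane. -/
noncomputable def distDiag (x : Plane) : ℝ≥0∞ := Metric.infEDist x diagonal

theorem continuous_distDiag : Continuous distDiag := Metric.continuous_infEDist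

theorem distDiag_eq_ofReal (x : Plane) :
    distDiag x = ENNReal.ofReal (Metric.infDist x diagonal) :=
  (ENNReal.ofReal_toReal (Metric.infEDist_ne_top diagonal_nonempty)).symm

theorem distDiag_of_mem {x : Plane} (hx : x ∈ diagonal) : distDiag x = 0 :=
  Metric.infEDist_zero_of_mem hx

theorem distDiag_ne_zero {x : Plane} (hx : x ∈ upperHalf) : distDiag x ≠ 0 := fun h =>
  not_mem_diagonal hx ((Metric.mem_iff_infEDist_zero_of_closed isClosed_diagonal).2 h)

theorem distDiag_le_add (x y : Plane) : distDiag x ≤ distDiag y + edist x y :=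
  Metric.infEDist_le_infEDist_add_edist

theorem pers_eq (p : ℝ) (μ : Measure upperHalf) : Pers p μ = ∫⁻ x, distDiag x ^ p ∂μ := rfl

/-! ### Marginals of admissible plans and Minkowski's inequality. -/

namespace IsAdmissible

variable {μ ν : Measure upperHalf} {π : Measure (closedHalf × closedHalf)}

/-- Restricting to the range of `incl` discards the uncontrolled mass over the diagonal; this is why
the transfer of integrals below requires functions vanishing there. -/
theorem map_fst (h : IsAdmissible μ ν π) :
    (π.map Prod.fst).restrict (Set.range incl) = μ.map incl := by
  ext B hB
  rw [Measure.restrict_apply hB,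
    Measure.map_apply measurable_fst (hB.inter measurableSet_range_incl),
    Measure.map_apply measurable_incl hB, ← h.fst_marginal _ (measurable_incl hB),
    Set.image_preimage_eq_inter_range, Set.prod_univ]

theorem map_snd (h : IsAdmissible μ ν π) :
    (π.map Prod.snd).restrict (Set.range incl) = ν.map incl := by
  ext B hB
  rw [Measure.restrict_apply hB,
    Measure.map_apply measurable_snd (hB.inter measurableSet_range_incl),
    Measure.map_apply measurable_incl hB, ← h.snd_marginal _ (measurable_incl hB),
    Set.image_preimage_eq_inter_range, Set.univ_prod]

theorem lintegral_fst (h : IsAdmissible μ ν π) {g : closedHalf → ℝ≥0∞} (hg : Measurable g)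
    (h0 : ∀ x : closedHalf, (x : Plane) ∈ diagonal → g x = 0) :
    ∫⁻ z, g z.1 ∂π = ∫⁻ x, g (incl x) ∂μ := by
  rw [← lintegral_map hg measurable_incl, ← h.map_fst, ← lintegral_map hg measurable_fst,
    setLIntegral_eq_of_support_subset]
  intro x hx
  exact mem_range_incl.2 fun hd => hx (h0 x hd)

theorem lintegral_snd (h : IsAdmissible μ ν π) {g : closedHalf → ℝ≥0∞} (hg : Measurable g)
    (h0 : ∀ x : closedHalf, (x : Plane) ∈ diagonal → g x = 0) :
    ∫⁻ z, g z.2 ∂π = ∫⁻ x, g (incl x) ∂ν := by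
  rw [← lintegral_map hg measurable_incl, ← h.map_snd, ← lintegral_map hg measurable_snd,
    setLIntegral_eq_of_support_subset]
  intro x hx
  exact mem_range_incl.2 fun hd => hx (h0 x hd)

theorem integral_fst (h : IsAdmissible μ ν π) {g : closedHalf → ℝ} (hg : Measurable g)
    (h0 : ∀ x : closedHalf, (x : Plane) ∈ diagonal → g x = 0) :
    ∫ z, g z.1 ∂π = ∫ x, g (incl x) ∂μ := by
  rw [← integral_map measurable_incl.aemeasurable hg.aestronglyMeasurable, ← h.map_fst,
    ← integral_map measurable_fst.aemeasurable hg.aestronglyMeasurable,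
    setIntegral_eq_integral_of_forall_compl_eq_zero]
  exact fun x hx => h0 x (not_not.1 fun hd => hx (mem_range_incl.2 hd))

theorem integral_snd (h : IsAdmissible μ ν π) {g : closedHalf → ℝ} (hg : Measurable g)
    (h0 : ∀ x : closedHalf, (x : Plane) ∈ diagonal → g x = 0) :
    ∫ z, g z.2 ∂π = ∫ x, g (incl x) ∂ν := by
  rw [← integral_map measurable_incl.aemeasurable hg.aestronglyMeasurable, ← h.map_snd,
    ← integral_map measurable_snd.aemeasurable hg.aestronglyMeasurable,
    setIntegral_eq_integral_of_forall_compl_eq_zero]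
  exact fun x hx => h0 x (not_not.1 fun hd => hx (mem_range_incl.2 hd))

end IsAdmissible

theorem measurable_distDiag_coe : Measurable fun x : closedHalf => distDiag x :=
  (continuous_distDiag.comp continuous_subtype_val).measurable

theorem measurable_distDiag_rpow (p : ℝ) : Measurable fun x : closedHalf => distDiag x ^ p :=
  measurable_distDiag_coe.pow_const p

namespace IsAdmissible

variable {μ ν : Measure upperHalf} {π : Measure (closedHalf × closedHalf)} {p : ℝ}

theorem lintegral_distDiag_fst (h : IsAdmissible μ ν π) (hp : 0 < p) :
    ∫⁻ z, distDiag z.1 ^ p ∂π = Pers p μ :=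
  h.lintegral_fst (measurable_distDiag_rpow p) fun x hx => by
    rw [distDiag_of_mem hx, ENNReal.zero_rpow_of_pos hp]

theorem lintegral_distDiag_snd (h : IsAdmissible μ ν π) (hp : 0 < p) :
    ∫⁻ z, distDiag z.2 ^ p ∂π = Pers p ν :=
  h.lintegral_snd (measurable_distDiag_rpow p) fun x hx => by
    rw [distDiag_of_mem hx, ENNReal.zero_rpow_of_pos hp]

theorem pers_fst_rpow_le (h : IsAdmissible μ ν π) (hp : 1 ≤ p) :
    Pers p μ ^ (1 / p) ≤ Pers p ν ^ (1 / p) + cost p π ^ (1 / p) := by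
  have hp0 : 0 < p := by linarith
  rw [← h.lintegral_distDiag_fst hp0, ← h.lintegral_distDiag_snd hp0]
  refine le_trans ?_ (ENNReal.lintegral_Lp_add_le
    (measurable_distDiag_coe.comp measurable_snd).aemeasurable
    (measurable_fst.edist measurable_snd).aemeasurable hp)
  gcongr with z
  exact distDiag_le_add _ _

theorem pers_snd_rpow_le (h : IsAdmissible μ ν π) (hp : 1 ≤ p) :
    Pers p ν ^ (1 / p) ≤ Pers p μ ^ (1 / p) + cost p π ^ (1 / p) := by
  have hp0 : 0 < p := by linarith
  rw [← h.lintegral_distDiag_fst hp0, ← h.lintegral_distDiag_snd hp0]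
  refine le_trans ?_ (ENNReal.lintegral_Lp_add_le
    (measurable_distDiag_coe.comp measurable_fst).aemeasurable
    (measurable_fst.edist measurable_snd).aemeasurable hp)
  gcongr with z
  refine (distDiag_le_add (z.2 : Plane) z.1).trans_eq ?_
  rw [edist_comm]
  rfl

end IsAdmissible

/-! ### Test functions against transport plans. -/

/-- The support stays at distance at least c from the diagonal. For |x - y| < r, uniform continuity
bounds the difference by ε c^p, and if it is nonzero one of the points lies in the support, where c
≤ d. For |x - y| ≥ r, the trivial bound 2M is absorbed by C = 2M / r^p. -/
theorem exists_abs_sub_le {F : Plane → ℝ} (hF : Continuous F) (hc : HasCompactSupport F)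
    (hs : tsupport F ⊆ upperHalf) {p : ℝ} (hp : 0 < p) {ε : ℝ} (hε : 0 < ε) :
    ∃ C : ℝ, 0 ≤ C ∧ ∀ x y : Plane, |F x - F y| ≤
      ε * (Metric.infDist x diagonal ^ p + Metric.infDist y diagonal ^ p) + C * dist x y ^ p := by
  obtain ⟨c, hc0, hcK⟩ : ∃ c : ℝ, 0 < c ∧ ∀ x ∈ tsupport F, c ≤ Metric.infDist x diagonal :=
    hc.isCompact.exists_forall_le' (Metric.continuous_infDist_pt _).continuousOn fun x hx =>
      (isClosed_diagonal.notMem_iff_infDist_pos diagonal_nonempty).1 (not_mem_diagonal (hs hx))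
  obtain ⟨M, hM⟩ := hF.bounded_above_of_compact_support hc
  have hM0 : 0 ≤ M := (norm_nonneg _).trans (hM 0)
  obtain ⟨r, hr, hFr⟩ := Metric.uniformContinuous_iff.1
    (hF.uniformContinuous_of_tendsto_cocompact hc.is_zero_at_infty) (ε * c ^ p) (by positivity)
  have hD (x : Plane) : 0 ≤ Metric.infDist x diagonal ^ p :=
    Real.rpow_nonneg Metric.infDist_nonneg _
  have hKp (x : Plane) (hx : x ∈ tsupport F) : ε * c ^ p ≤ ε * Metric.infDist x diagonal ^ p := by
    have := hcK x hx
    gcongr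
  refine ⟨2 * M / r ^ p, by positivity, fun x y => ?_⟩
  rcases lt_or_ge (dist x y) r with hxy | hxy
  · have h1 : 0 ≤ 2 * M / r ^ p * dist x y ^ p := by positivity
    have h2 := hFr hxy
    rw [Real.dist_eq] at h2
    have h3 := mul_nonneg hε.le (hD x)
    have h4 := mul_nonneg hε.le (hD y)
    by_cases hx : x ∈ tsupport F
    · linarith [hKp x hx]
    by_cases hy : y ∈ tsupport F
    · linarith [hKp y hy]
    rw [image_eq_zero_of_notMem_tsupport hx, image_eq_zero_of_notMem_tsupport hy,
      sub_zero, abs_zero]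
    linarith
  · have h1 : |F x - F y| ≤ 2 * M := by
      have := abs_sub (F x) (F y)
      have hx := hM x
      have hy := hM y
      rw [Real.norm_eq_abs] at hx hy
      linarith
    have h2 : 2 * M ≤ 2 * M / r ^ p * dist x y ^ p := by
      rw [div_mul_eq_mul_div, le_div_iff₀ (by positivity)]
      gcongr
    have h3 : 0 ≤ ε * (Metric.infDist x diagonal ^ p + Metric.infDist y diagonal ^ p) :=
      mul_nonneg hε.le (add_nonneg (hD x) (hD y))
    linarith

theorem exists_enorm_sub_le {F : Plane → ℝ} (hF : Continuous F) (hc : HasCompactSupport F)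
    (hs : tsupport F ⊆ upperHalf) {p : ℝ} (hp : 0 < p) {ε : ℝ} (hε : 0 < ε) :
    ∃ C : ℝ≥0∞, C ≠ ∞ ∧ ∀ x y : Plane, ‖F x - F y‖ₑ ≤
      ENNReal.ofReal ε * (distDiag x ^ p + distDiag y ^ p) + C * edist x y ^ p := by
  obtain ⟨C, hC, h⟩ := exists_abs_sub_le hF hc hs hp hε
  refine ⟨ENNReal.ofReal C, ENNReal.ofReal_ne_top, fun x y => ?_⟩
  have hD (x : Plane) : 0 ≤ Metric.infDist x diagonal ^ p :=
    Real.rpow_nonneg Metric.infDist_nonneg _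
  rw [distDiag_eq_ofReal, distDiag_eq_ofReal, edist_dist,
    ENNReal.ofReal_rpow_of_nonneg Metric.infDist_nonneg hp.le,
    ENNReal.ofReal_rpow_of_nonneg Metric.infDist_nonneg hp.le,
    ENNReal.ofReal_rpow_of_nonneg dist_nonneg hp.le, ← ENNReal.ofReal_add (hD x) (hD y),
    ← ENNReal.ofReal_mul hε.le, ← ENNReal.ofReal_mul hC, ← ENNReal.ofReal_add
      (mul_nonneg hε.le (add_nonneg (hD x) (hD y))) (by positivity), Real.enorm_eq_ofReal_abs]
  exact ENNReal.ofReal_le_ofReal (h x y)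

/-- Extension by zero of a compactly supported continuous function on the half-plane. -/
theorem exists_extension (f : C_c(upperHalf, ℝ)) :
    ∃ F : Plane → ℝ, Continuous F ∧ HasCompactSupport F ∧ tsupport F ⊆ upperHalf ∧
      ∀ x : upperHalf, F x = f x := by
  have hsub := f.hasCompactSupport.tsupport_extend_zero_subset continuous_subtype_val
  refine ⟨Subtype.val.extend f 0,
    f.hasCompactSupport.continuous_extend_zero isOpen_upperHalf (map_continuous f), ?_, ?_,
    fun x => Subtype.val_injective.extend_apply _ _ x⟩
  · exact (f.hasCompactSupport.isCompact.image continuous_subtype_val).of_isClosed_subset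
      (isClosed_tsupport _) hsub
  · exact hsub.trans (Subtype.coe_image_subset _ _)

theorem integrable_of_compactlySupported {μ : Measure upperHalf} [IsFiniteMeasureOnCompacts μ]
    (f : C_c(upperHalf, ℝ)) : Integrable f μ :=
  (map_continuous f).integrable_of_hasCompactSupport f.hasCompactSupport

theorem IsAdmissible.lintegral_add_eq {μ ν : Measure upperHalf}
    {π : Measure (closedHalf × closedHalf)} (h : IsAdmissible μ ν π) {p : ℝ} (hp : 0 < p)
    (a C : ℝ≥0∞) :
    ∫⁻ z, (a * (distDiag z.1 ^ p + distDiag z.2 ^ p) + C * edist z.1 z.2 ^ p) ∂π =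
      a * (Pers p μ + Pers p ν) + C * cost p π := by
  have m1 : Measurable fun z : closedHalf × closedHalf => distDiag z.1 ^ p :=
    (measurable_distDiag_rpow p).comp measurable_fst
  have m2 : Measurable fun z : closedHalf × closedHalf => distDiag z.2 ^ p :=
    (measurable_distDiag_rpow p).comp measurable_snd
  have m3 : Measurable fun z : closedHalf × closedHalf => edist z.1 z.2 ^ p :=
    (measurable_fst.edist measurable_snd).pow_const p
  have m12 : Measurable fun z : closedHalf × closedHalf => distDiag z.1 ^ p + distDiag z.2 ^ p :=
    m1.add m2
  rw [lintegral_add_right _ (m3.const_mul C), lintegral_const_mul _ m3,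
    lintegral_const_mul a m12, lintegral_add_left m1, h.lintegral_distDiag_fst hp,
    h.lintegral_distDiag_snd hp]
  rfl

theorem IsAdmissible.enorm_integral_sub_le {μ ν : Measure upperHalf}
    [IsFiniteMeasureOnCompacts μ] [IsFiniteMeasureOnCompacts ν]
    {π : Measure (closedHalf × closedHalf)} (h : IsAdmissible μ ν π) {p : ℝ} (hp : 0 < p)
    {f : C_c(upperHalf, ℝ)} {F : Plane → ℝ} (hF : Continuous F) (hs : tsupport F ⊆ upperHalf)
    (hFf : ∀ x : upperHalf, F x = f x) {a C : ℝ≥0∞}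
    (hC : ∀ x y : Plane, ‖F x - F y‖ₑ ≤
      a * (distDiag x ^ p + distDiag y ^ p) + C * edist x y ^ p) :
    ‖∫ x, f x ∂μ - ∫ x, f x ∂ν‖ₑ ≤ a * (Pers p μ + Pers p ν) + C * cost p π := by
  have hm : Measurable fun x : closedHalf => F x := (hF.comp continuous_subtype_val).measurable
  have h0 (x : closedHalf) (hx : (x : Plane) ∈ diagonal) : F x = 0 :=
    image_eq_zero_of_notMem_tsupport fun hx' => not_mem_diagonal (hs hx') hx
  have hint (ρ : Measure upperHalf) [IsFiniteMeasureOnCompacts ρ] :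
      ∫⁻ x, ‖F (incl x)‖ₑ ∂ρ < ∞ := by
    simp only [coe_incl, hFf]
    exact (integrable_of_compactlySupported f).hasFiniteIntegral
  have i1 : Integrable (fun z : closedHalf × closedHalf => F z.1) π := by
    refine ⟨(hm.comp measurable_fst).aestronglyMeasurable, ?_⟩
    rw [HasFiniteIntegral, h.lintegral_fst hm.enorm fun x hx => by rw [h0 x hx, enorm_zero]]
    exact hint μ
  have i2 : Integrable (fun z : closedHalf × closedHalf => F z.2) π := by
    refine ⟨(hm.comp measurable_snd).aestronglyMeasurable, ?_⟩
    rw [HasFiniteIntegral, h.lintegral_snd hm.enorm fun x hx => by rw [h0 x hx, enorm_zero]]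
    exact hint ν
  have e1 : ∫ z, F z.1 ∂π = ∫ x, f x ∂μ := by
    rw [h.integral_fst hm h0]
    simp only [coe_incl, hFf]
  have e2 : ∫ z, F z.2 ∂π = ∫ x, f x ∂ν := by
    rw [h.integral_snd hm h0]
    simp only [coe_incl, hFf]
  rw [← e1, ← e2, ← integral_sub i1 i2]
  rw [← h.lintegral_add_eq hp]
  exact (enorm_integral_le_lintegral_enorm _).trans (lintegral_mono fun z => hC z.1 z.2)

/-! ### Convergence in OT implies (i) and (ii). -/

theorem exists_admissible_cost_lt {p : ℝ} (hp : 0 < p) {μ ν : Measure upperHalf} {r : ℝ≥0∞}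
    (h : OT p μ ν < r) : ∃ π, IsAdmissible μ ν π ∧ cost p π ^ (1 / p) < r := by
  rw [OT, one_div, ENNReal.rpow_inv_lt_iff hp] at h
  simp only [iInf_lt_iff] at h
  obtain ⟨π, hπ, hlt⟩ := h
  refine ⟨π, hπ, ?_⟩
  rwa [one_div, ENNReal.rpow_inv_lt_iff hp]

theorem exists_plans_of_tendsto {p : ℝ} (hp : 0 < p) {μ : Measure upperHalf}
    {μs : ℕ → Measure upperHalf} (h : Tendsto (fun n => OT p (μs n) μ) atTop (𝓝 0)) :
    ∃ π : ℕ → Measure (closedHalf × closedHalf), (∀ᶠ n in atTop, IsAdmissible (μs n) μ (π n)) ∧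
      Tendsto (fun n => cost p (π n) ^ (1 / p)) atTop (𝓝 0) := by
  have key (n : ℕ) : ∃ π, OT p (μs n) μ < ∞ →
      IsAdmissible (μs n) μ π ∧ cost p π ^ (1 / p) < OT p (μs n) μ + ((n : ℝ≥0∞) + 1)⁻¹ := by
    by_cases hn : OT p (μs n) μ < ∞
    · obtain ⟨π, hπ⟩ := exists_admissible_cost_lt hp
        (ENNReal.lt_add_right hn.ne (b := ((n : ℝ≥0∞) + 1)⁻¹) (by simp))
      exact ⟨π, fun _ => hπ⟩
    -- Junk value: admissibility is claimed only where OT is finite, hence only eventually.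
    · exact ⟨0, fun h => absurd h hn⟩
  choose π hπ using key
  have hfin : ∀ᶠ n in atTop, OT p (μs n) μ < ∞ := h.eventually_lt_const ENNReal.zero_lt_top
  refine ⟨π, hfin.mono fun n hn => (hπ n hn).1, ?_⟩
  have hinv : Tendsto (fun n : ℕ => ((n : ℝ≥0∞) + 1)⁻¹) atTop (𝓝 0) := by
    have := (tendsto_add_atTop_iff_nat 1).2 ENNReal.tendsto_inv_nat_nhds_zero
    simpa using this
  have hlim := h.add hinv
  rw [add_zero] at hlim
  exact tendsto_of_tendsto_of_tendsto_of_le_of_le' tendsto_const_nhds hlim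
    (Eventually.of_forall fun _ => zero_le) (hfin.mono fun n hn => (hπ n hn).2.le)

theorem tendsto_pers_of_tendsto_OT {p : ℝ} (hp : 1 ≤ p) {μ : Measure upperHalf}
    {μs : ℕ → Measure upperHalf} (hμ : μ ∈ MeasuresWithFinitePers p)
    (h : Tendsto (fun n => OT p (μs n) μ) atTop (𝓝 0)) :
    Tendsto (fun n => Pers p (μs n)) atTop (𝓝 (Pers p μ)) := by
  have hp0 : 0 < p := by linarith
  obtain ⟨π, hπ, hc⟩ := exists_plans_of_tendsto hp0 h
  have hfin : Pers p μ ^ (1 / p) ≠ ∞ := ENNReal.rpow_ne_top_of_nonneg (by positivity) hμ.2.ne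
  have hup := (tendsto_const_nhds (x := Pers p μ ^ (1 / p))).add hc
  have hlo := ENNReal.Tendsto.sub (tendsto_const_nhds (x := Pers p μ ^ (1 / p))) hc (Or.inl hfin)
  rw [add_zero] at hup
  rw [tsub_zero] at hlo
  have hlim : Tendsto (fun n => Pers p (μs n) ^ (1 / p)) atTop (𝓝 (Pers p μ ^ (1 / p))) :=
    tendsto_of_tendsto_of_tendsto_of_le_of_le' hlo hup
      (hπ.mono fun n hn => tsub_le_iff_right.2 (hn.pers_snd_rpow_le hp))
      (hπ.mono fun n hn => hn.pers_fst_rpow_le hp)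
  have := hlim.ennrpow_const p
  simpa only [one_div, ENNReal.rpow_inv_rpow hp0.ne'] using this

theorem vaguelyTendsto_of_tendsto_OT {p : ℝ} (hp : 1 ≤ p) {μ : Measure upperHalf}
    {μs : ℕ → Measure upperHalf} (hμ : μ ∈ MeasuresWithFinitePers p)
    (hμs : ∀ n, μs n ∈ MeasuresWithFinitePers p)
    (h : Tendsto (fun n => OT p (μs n) μ) atTop (𝓝 0)) : VaguelyTendsto μs μ := by
  intro f
  have hp0 : 0 < p := by linarith
  have hpers := tendsto_pers_of_tendsto_OT hp hμ h
  obtain ⟨π, hπ, hc⟩ := exists_plans_of_tendsto hp0 h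
  have hcost : Tendsto (fun n => cost p (π n)) atTop (𝓝 0) := by
    have := hc.ennrpow_const p
    simpa only [one_div, ENNReal.rpow_inv_rpow hp0.ne', ENNReal.zero_rpow_of_pos hp0] using this
  obtain ⟨F, hF, hFc, hFs, hFf⟩ := exists_extension f
  have := hμ.1
  have := fun n => (hμs n).1
  rw [tendsto_iff_edist_tendsto_0, ENNReal.tendsto_nhds_zero]
  intro ε hε
  -- C depends on η, but the vanishing cost kills its term; the limiting bound is 2η Pers(μ), so η
  -- is chosen from that alone.
  obtain ⟨η, hη, hηε⟩ : ∃ η : ℝ, 0 < η ∧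
      ENNReal.ofReal η * (Pers p μ + Pers p μ) < ε := by
    have hlim : Tendsto (fun η : ℝ => ENNReal.ofReal η * (Pers p μ + Pers p μ)) (𝓝[>] 0) (𝓝 0) := by
      have h1 := ENNReal.Tendsto.mul_const (b := Pers p μ + Pers p μ)
        (ENNReal.tendsto_ofReal (tendsto_id (α := ℝ) (x := 𝓝 0)))
        (Or.inr (ENNReal.add_ne_top.2 ⟨hμ.2.ne, hμ.2.ne⟩))
      simp only [id, ENNReal.ofReal_zero, zero_mul] at h1
      exact h1.mono_left nhdsWithin_le_nhds
    obtain ⟨η, h1, h2⟩ := ((hlim.eventually_lt_const hε).and self_mem_nhdsWithin).exists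
    exact ⟨η, h2, h1⟩
  obtain ⟨C, hC, hle⟩ := exists_enorm_sub_le hF hFc hFs hp0 hη
  have hlim : Tendsto (fun n => ENNReal.ofReal η * (Pers p (μs n) + Pers p μ) + C * cost p (π n))
      atTop (𝓝 (ENNReal.ofReal η * (Pers p μ + Pers p μ) + C * 0)) :=
    (ENNReal.Tendsto.const_mul (hpers.add tendsto_const_nhds) (Or.inr ENNReal.ofReal_ne_top)).add
      (ENNReal.Tendsto.const_mul hcost (Or.inr hC))
  rw [mul_zero, add_zero] at hlim
  filter_upwards [hπ, hlim.eventually_lt_const hηε] with n hn hlt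
  rw [edist_eq_enorm_sub]
  exact (hn.enorm_integral_sub_le hp0 hF hFs hFf hle).trans hlt.le

/-! ### Admissibility from the marginals, and projection to the diagonal. -/

theorem measurable_distDiag_upperHalf (p : ℝ) :
    Measurable fun x : upperHalf => distDiag x ^ p :=
  (continuous_distDiag.comp continuous_subtype_val).measurable.pow_const p

/-- Markov's inequality for d^p. The set is unbounded, so local finiteness would not suffice. -/
theorem measure_le_distDiag_lt_top {p : ℝ} (hp : 0 < p) {μ : Measure upperHalf}
    (hμ : Pers p μ < ∞) {c : ℝ≥0∞} (hc : c ≠ 0) (hc' : c ≠ ∞) :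
    μ {x | c ≤ distDiag x} < ∞ := by
  have hcp : c ^ p ≠ 0 := by simp [ENNReal.rpow_eq_zero_iff, hc, hc']
  have hcp' : c ^ p ≠ ∞ := ENNReal.rpow_ne_top_of_nonneg hp.le hc'
  refine lt_of_le_of_lt (measure_mono fun x hx => ?_)
    ((meas_ge_le_lintegral_div (measurable_distDiag_upperHalf p).aemeasurable hcp hcp').trans_lt
      (ENNReal.div_lt_top hμ.ne hcp))
  exact ENNReal.rpow_le_rpow hx hp.le

theorem infDist_pos_iff (x : Plane) : 0 < Metric.infDist x diagonal ↔ x ∉ diagonal :=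
  (isClosed_diagonal.notMem_iff_infDist_pos diagonal_nonempty).symm

theorem mem_image_incl_of_le_infDist {c : ℝ} (hc : 0 < c) (x : closedHalf)
    (hx : c ≤ Metric.infDist (x : Plane) diagonal) :
    x ∈ incl '' {y : upperHalf | ENNReal.ofReal c ≤ distDiag y} := by
  obtain ⟨y, rfl⟩ := mem_range_incl.2 ((infDist_pos_iff x).1 (hc.trans_le hx))
  refine ⟨y, ?_, rfl⟩
  rw [Set.mem_ofPred_eq, distDiag_eq_ofReal]
  exact ENNReal.ofReal_le_ofReal hx

theorem exists_subset_of_isCompact {K : Set (closedHalf × closedHalf)} (hK : IsCompact K)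
    (hKo : K ⊆ offDiagonal) : ∃ c : ℝ, 0 < c ∧
      K ⊆ (incl '' {y : upperHalf | ENNReal.ofReal c ≤ distDiag y}) ×ˢ Set.univ ∪
        Set.univ ×ˢ (incl '' {y : upperHalf | ENNReal.ofReal c ≤ distDiag y}) := by
  have hcont : Continuous fun x : closedHalf => Metric.infDist (x : Plane) diagonal :=
    (Metric.continuous_infDist_pt _).comp continuous_subtype_val
  have hcont2 : Continuous fun z : closedHalf × closedHalf =>
      max (Metric.infDist (z.1 : Plane) diagonal) (Metric.infDist (z.2 : Plane) diagonal) :=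
    (hcont.comp continuous_fst).max (hcont.comp continuous_snd)
  obtain ⟨c, hc, hcK⟩ := hK.exists_forall_le' hcont2.continuousOn (a := 0) fun z hz => by
    rw [lt_max_iff, infDist_pos_iff, infDist_pos_iff]
    exact not_and_or.1 (hKo hz)
  refine ⟨c, hc, fun z hz => ?_⟩
  rcases le_max_iff.1 (hcK z hz) with h | h
  · exact Or.inl ⟨mem_image_incl_of_le_infDist hc _ h, trivial⟩
  · exact Or.inr ⟨trivial, mem_image_incl_of_le_infDist hc _ h⟩

/-- On a compact part of E_Ω the larger of the two distances to the diagonal is bounded below, so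
two cylinders of finite mass cover it. -/
theorem isAdmissible_of_marginals {p : ℝ} (hp : 0 < p) {μ ν : Measure upperHalf}
    (hμ : Pers p μ < ∞) (hν : Pers p ν < ∞) {π : Measure (closedHalf × closedHalf)}
    (h1 : ∀ A : Set upperHalf, MeasurableSet A → π ((incl '' A) ×ˢ Set.univ) = μ A)
    (h2 : ∀ B : Set upperHalf, MeasurableSet B → π (Set.univ ×ˢ (incl '' B)) = ν B) :
    IsAdmissible μ ν π := by
  refine ⟨fun K hK hKo => ?_, h1, h2⟩
  obtain ⟨c, hc, hsub⟩ := exists_subset_of_isCompact hK hKo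
  have hc0 : ENNReal.ofReal c ≠ 0 := (ENNReal.ofReal_pos.2 hc).ne'
  have hm : MeasurableSet {x : upperHalf | ENNReal.ofReal c ≤ distDiag x} :=
    measurableSet_le measurable_const (continuous_distDiag.comp continuous_subtype_val).measurable
  refine (measure_mono hsub).trans_lt ((measure_union_le _ _).trans_lt ?_)
  rw [h1 _ hm, h2 _ hm]
  exact ENNReal.add_lt_top.2 ⟨measure_le_distDiag_lt_top hp hμ hc0 ENNReal.ofReal_ne_top,
    measure_le_distDiag_lt_top hp hν hc0 ENNReal.ofReal_ne_top⟩

/-- The orthogonal projection onto the diagonal. -/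
noncomputable def proj (x : upperHalf) : closedHalf :=
  ⟨!₂[((x : Plane) 0 + (x : Plane) 1) / 2, ((x : Plane) 0 + (x : Plane) 1) / 2],
    Or.inr (by simp [diagonal])⟩

theorem measurable_proj : Measurable proj := by
  have h : Continuous fun x : Plane => (!₂[(x 0 + x 1) / 2, (x 0 + x 1) / 2] : Plane) := by fun_prop
  exact ((h.comp continuous_subtype_val).subtype_mk _).measurable

theorem proj_mem_diagonal (x : upperHalf) : (proj x : Plane) ∈ diagonal := by
  simp [proj, diagonal]

theorem proj_ne_incl (x y : upperHalf) : incl y ≠ proj x := fun h =>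
  mem_range_incl.1 ⟨y, h⟩ (proj_mem_diagonal x)

theorem edist_proj_le (x : upperHalf) : edist (incl x) (proj x) ≤ distDiag x := by
  refine Metric.le_infEDist.2 fun y (hy : y 0 = y 1) => ?_
  change edist (x : Plane) (proj x : Plane) ≤ _
  rw [edist_dist, edist_dist, EuclideanSpace.dist_eq, EuclideanSpace.dist_eq]
  refine ENNReal.ofReal_le_ofReal (Real.sqrt_le_sqrt ?_)
  simp only [Fin.sum_univ_two, Real.dist_eq, sq_abs, proj, ← hy]
  simp
  -- The squared distances differ by half of this square.
  nlinarith [sq_nonneg ((x : Plane) 0 + (x : Plane) 1 - 2 * y 0)]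

/-! ### The explicit plan: marginals and cost. -/

section Plan

variable {ι : Type*} [Fintype ι]

/-- The part of a measure left over once the densities `a i * φ i` are removed. -/
noncomputable def leftover (μ : Measure upperHalf) (φ : ι → upperHalf → ℝ≥0∞) (a : ι → ℝ≥0∞) :
    Measure upperHalf :=
  μ.withDensity fun x => 1 - ∑ i, a i * φ i x

/-- The plan which couples `φ i • μ` with `φ i • ν` by a multiple of the product measure and sends
the remaining mass to the diagonal. -/
noncomputable def plan (μ ν : Measure upperHalf) (φ : ι → upperHalf → ℝ≥0∞) (c : ι → ℝ≥0∞) :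
    Measure (closedHalf × closedHalf) :=
  ∑ i, c i • ((μ.withDensity (φ i)).prod (ν.withDensity (φ i))).map (Prod.map incl incl) +
    (leftover μ φ fun i => c i * ∫⁻ x, φ i x ∂ν).map (fun x => (incl x, proj x)) +
    (leftover ν φ fun i => c i * ∫⁻ x, φ i x ∂μ).map (fun x => (proj x, incl x))

variable {μ ν : Measure upperHalf} {φ : ι → upperHalf → ℝ≥0∞} {a c : ι → ℝ≥0∞}

theorem sum_mul_le_one (hφ : ∀ x, ∑ i, φ i x ≤ 1) (ha : ∀ i, a i ≤ 1) (x : upperHalf) :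
    ∑ i, a i * φ i x ≤ 1 :=
  (Finset.sum_le_sum fun i _ => mul_le_of_le_one_left zero_le (ha i)).trans (hφ x)

theorem measurable_sum_mul (hm : ∀ i, Measurable (φ i)) :
    Measurable fun x => ∑ i, a i * φ i x :=
  Finset.measurable_sum _ fun i _ => (hm i).const_mul _

/-- The identity holds pointwise under the integral: the removed density is at most 1, so the
truncated subtraction is exact. -/
theorem sum_mul_lintegral_add_leftover (hm : ∀ i, Measurable (φ i)) (hφ : ∀ x, ∑ i, φ i x ≤ 1)
    (ha : ∀ i, a i ≤ 1) {g : upperHalf → ℝ≥0∞} (hg : Measurable g) :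
    ∑ i, a i * ∫⁻ x, φ i x * g x ∂μ + ∫⁻ x, g x ∂(leftover μ φ a) = ∫⁻ x, g x ∂μ := by
  rw [leftover, lintegral_withDensity_eq_lintegral_mul _
    (show Measurable fun x => 1 - ∑ i, a i * φ i x from
      measurable_const.sub (measurable_sum_mul hm)) hg]
  have hmg (i : ι) : Measurable fun x => φ i x * g x := (hm i).mul hg
  have hmag (i : ι) : Measurable fun x => a i * (φ i x * g x) := (hmg i).const_mul _
  have e (i : ι) : a i * ∫⁻ x, φ i x * g x ∂μ = ∫⁻ x, a i * (φ i x * g x) ∂μ :=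
    (lintegral_const_mul _ (hmg i)).symm
  rw [Finset.sum_congr rfl fun i _ => e i, ← lintegral_finsetSum _ fun i _ => hmag i,
    ← lintegral_add_left (Finset.measurable_sum _ fun i _ => hmag i)]
  refine lintegral_congr fun x => ?_
  simp_rw [← mul_assoc, ← Finset.sum_mul, Pi.mul_apply]
  rw [← add_mul, add_tsub_cancel_of_le (sum_mul_le_one hφ ha x), one_mul]

theorem sum_mul_withDensity_add_leftover (hm : ∀ i, Measurable (φ i))
    (hφ : ∀ x, ∑ i, φ i x ≤ 1) (ha : ∀ i, a i ≤ 1) {A : Set upperHalf} (hA : MeasurableSet A) :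
    ∑ i, a i * μ.withDensity (φ i) A + leftover μ φ a A = μ A := by
  have h := sum_mul_lintegral_add_leftover (μ := μ) hm hφ ha
    (measurable_one.indicator hA : Measurable (A.indicator (1 : upperHalf → ℝ≥0∞)))
  rw [lintegral_indicator_one hA, lintegral_indicator_one hA] at h
  rw [← h]
  congr 1
  refine Finset.sum_congr rfl fun i _ => ?_
  rw [withDensity_apply _ hA, ← lintegral_indicator hA]
  congr 2 with x
  by_cases hx : x ∈ A <;> simp [hx]

/-- The i-th product projects to c_i (∫ φ_i dν) φ_i μ, exactly what `leftover` removes from μ; the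
last summand has its first coordinate on the diagonal and adds nothing. -/
theorem plan_fst_marginal [SFinite ν] (hm : ∀ i, Measurable (φ i)) (hφ : ∀ x, ∑ i, φ i x ≤ 1)
    (hc : ∀ i, c i * ∫⁻ x, φ i x ∂ν ≤ 1) {A : Set upperHalf} (hA : MeasurableSet A) :
    plan μ ν φ c ((incl '' A) ×ˢ Set.univ) = μ A := by
  have hA' : MeasurableSet ((incl '' A) ×ˢ (Set.univ : Set closedHalf)) :=
    (measurableEmbedding_incl.measurableSet_image' hA).prod .univ
  rw [plan, Measure.add_apply, Measure.add_apply, Measure.finsetSum_apply,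
    Measure.map_apply (measurable_incl.prodMk measurable_proj) hA',
    Measure.map_apply (measurable_proj.prodMk measurable_incl) hA',
    ← sum_mul_withDensity_add_leftover (μ := μ) hm hφ hc hA]
  have e1 : (fun x => (incl x, proj x)) ⁻¹' ((incl '' A) ×ˢ Set.univ) = A := by
    ext x
    simp [incl_injective.mem_set_image]
  have e2 : (fun x => (proj x, incl x)) ⁻¹' ((incl '' A) ×ˢ Set.univ) = ∅ := by
    ext x
    simp [proj_ne_incl]
  have e3 : Prod.map incl incl ⁻¹' ((incl '' A) ×ˢ Set.univ) = A ×ˢ Set.univ := by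
    ext x
    simp [incl_injective.mem_set_image]
  rw [e1, e2, measure_empty, add_zero]
  congr 1
  refine Finset.sum_congr rfl fun i _ => ?_
  rw [Measure.smul_apply, Measure.map_apply (measurable_incl.prodMap measurable_incl) hA', e3,
    Measure.prod_prod, withDensity_apply _ .univ, Measure.restrict_univ, smul_eq_mul, mul_assoc,
    mul_comm (∫⁻ x, φ i x ∂ν)]

theorem plan_snd_marginal [SFinite ν] (hm : ∀ i, Measurable (φ i)) (hφ : ∀ x, ∑ i, φ i x ≤ 1)
    (hc : ∀ i, c i * ∫⁻ x, φ i x ∂μ ≤ 1) {A : Set upperHalf} (hA : MeasurableSet A) :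
    plan μ ν φ c (Set.univ ×ˢ (incl '' A)) = ν A := by
  have hA' : MeasurableSet ((Set.univ : Set closedHalf) ×ˢ (incl '' A)) :=
    MeasurableSet.univ.prod (measurableEmbedding_incl.measurableSet_image' hA)
  rw [plan, Measure.add_apply, Measure.add_apply, Measure.finsetSum_apply,
    Measure.map_apply (measurable_incl.prodMk measurable_proj) hA',
    Measure.map_apply (measurable_proj.prodMk measurable_incl) hA',
    ← sum_mul_withDensity_add_leftover (μ := ν) hm hφ hc hA]
  have e1 : (fun x => (proj x, incl x)) ⁻¹' (Set.univ ×ˢ (incl '' A)) = A := by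
    ext x
    simp [incl_injective.mem_set_image]
  have e2 : (fun x => (incl x, proj x)) ⁻¹' (Set.univ ×ˢ (incl '' A)) = ∅ := by
    ext x
    simp [proj_ne_incl]
  have e3 : Prod.map incl incl ⁻¹' (Set.univ ×ˢ (incl '' A)) = Set.univ ×ˢ A := by
    ext x
    simp [incl_injective.mem_set_image]
  rw [e1, e2, measure_empty, add_zero]
  congr 1
  refine Finset.sum_congr rfl fun i _ => ?_
  rw [Measure.smul_apply, Measure.map_apply (measurable_incl.prodMap measurable_incl) hA', e3,
    Measure.prod_prod, withDensity_apply _ .univ, Measure.restrict_univ, smul_eq_mul, mul_assoc]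

theorem isAdmissible_plan [SFinite ν] {p : ℝ} (hp : 0 < p) (hμ : Pers p μ < ∞) (hν : Pers p ν < ∞)
    (hm : ∀ i, Measurable (φ i)) (hφ : ∀ x, ∑ i, φ i x ≤ 1)
    (hcμ : ∀ i, c i * ∫⁻ x, φ i x ∂μ ≤ 1) (hcν : ∀ i, c i * ∫⁻ x, φ i x ∂ν ≤ 1) :
    IsAdmissible μ ν (plan μ ν φ c) :=
  isAdmissible_of_marginals hp hμ hν (fun _ => plan_fst_marginal hm hφ hcν)
    fun _ => plan_snd_marginal hm hφ hcμ

theorem pers_leftover_eq {p : ℝ} (hμ : Pers p μ < ∞) (hm : ∀ i, Measurable (φ i))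
    (hφ : ∀ x, ∑ i, φ i x ≤ 1) (ha : ∀ i, a i ≤ 1) :
    Pers p (leftover μ φ a) = Pers p μ - ∑ i, a i * ∫⁻ x, φ i x * distDiag x ^ p ∂μ := by
  have h := sum_mul_lintegral_add_leftover (μ := μ) hm hφ ha (measurable_distDiag_upperHalf p)
  rw [← pers_eq, ← pers_eq] at h
  rw [← h] at hμ ⊢
  exact (ENNReal.add_sub_cancel_left (ENNReal.add_lt_top.1 hμ).1.ne).symm

theorem edist_incl (x y : upperHalf) : edist (incl x) (incl y) = edist x y := rfl

theorem measurable_cost (p : ℝ) :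
    Measurable fun z : closedHalf × closedHalf => edist z.1 z.2 ^ p :=
  (measurable_fst.edist measurable_snd).pow_const p

/-- Where both densities are nonzero the cost is bounded by a function of the second variable alone,
so the double integral factors. -/
theorem lintegral_prod_withDensity_le [SFinite ν] {p : ℝ} (hp : 0 < p) {f : upperHalf → ℝ≥0∞}
    (hf : Measurable f) {η : ℝ≥0∞}
    (h : ∀ x y, f x ≠ 0 → f y ≠ 0 → edist x y ≤ η * distDiag y) :
    ∫⁻ z, edist (incl z.1) (incl z.2) ^ p ∂((μ.withDensity f).prod (ν.withDensity f)) ≤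
      (∫⁻ x, f x ∂μ) * (η ^ p * ∫⁻ y, f y * distDiag y ^ p ∂ν) := by
  have hd : Measurable fun z : upperHalf × upperHalf => edist (incl z.1) (incl z.2) ^ p :=
    ((measurable_incl.comp measurable_fst).edist (measurable_incl.comp measurable_snd)).pow_const p
  have hm2 : Measurable fun y => f y * distDiag y ^ p := hf.mul (measurable_distDiag_upperHalf p)
  have hff : Measurable fun z : upperHalf × upperHalf => f z.1 * f z.2 :=
    (hf.comp measurable_fst).mul (hf.comp measurable_snd)
  have hle (z : upperHalf × upperHalf) :
      f z.1 * f z.2 * edist (incl z.1) (incl z.2) ^ p ≤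
        f z.1 * (η ^ p * (f z.2 * distDiag z.2 ^ p)) := by
    rcases eq_or_ne (f z.1) 0 with h1 | h1
    · simp only [h1, zero_mul, le_refl]
    rcases eq_or_ne (f z.2) 0 with h2 | h2
    · simp only [h2, zero_mul, mul_zero, le_refl]
    have h3 := ENNReal.rpow_le_rpow (h z.1 z.2 h1 h2) hp.le
    rw [ENNReal.mul_rpow_of_nonneg _ _ hp.le] at h3
    rw [edist_incl, mul_assoc, mul_left_comm (η ^ p)]
    gcongr
  have e1 : ∫⁻ z, edist (incl z.1) (incl z.2) ^ p ∂((μ.withDensity f).prod (ν.withDensity f)) =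
      ∫⁻ z, f z.1 * f z.2 * edist (incl z.1) (incl z.2) ^ p ∂(μ.prod ν) := by
    rw [prod_withDensity hf hf]
    exact lintegral_withDensity_eq_lintegral_mul _ hff hd
  have e2 : ∫⁻ z : upperHalf × upperHalf, f z.1 * (η ^ p * (f z.2 * distDiag z.2 ^ p)) ∂(μ.prod ν) =
      (∫⁻ x, f x ∂μ) * ∫⁻ y, η ^ p * (f y * distDiag y ^ p) ∂ν :=
    lintegral_prod_mul hf.aemeasurable (hm2.const_mul _).aemeasurable
  rw [e1, ← lintegral_const_mul _ hm2, ← e2]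
  exact lintegral_mono hle

theorem cost_plan_le [SFinite ν] {p : ℝ} (hp : 0 < p) (hm : ∀ i, Measurable (φ i)) {η : ℝ≥0∞}
    (h : ∀ i x y, φ i x ≠ 0 → φ i y ≠ 0 → edist x y ≤ η * distDiag y)
    (hcμ : ∀ i, c i * ∫⁻ x, φ i x ∂μ ≤ 1) :
    cost p (plan μ ν φ c) ≤ η ^ p * ∑ i, ∫⁻ y, φ i y * distDiag y ^ p ∂ν +
      Pers p (leftover μ φ fun i => c i * ∫⁻ x, φ i x ∂ν) +
      Pers p (leftover ν φ fun i => c i * ∫⁻ x, φ i x ∂μ) := by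
  rw [cost, plan, lintegral_add_measure, lintegral_add_measure, lintegral_finsetSum_measure,
    lintegral_map (measurable_cost p) (measurable_incl.prodMk measurable_proj),
    lintegral_map (measurable_cost p) (measurable_proj.prodMk measurable_incl), Finset.mul_sum]
  refine add_le_add (add_le_add (Finset.sum_le_sum fun i _ => ?_) (lintegral_mono fun x => ?_))
    (lintegral_mono fun x => ?_)
  · rw [lintegral_smul_measure, lintegral_map (measurable_cost p)
      (measurable_incl.prodMap measurable_incl), smul_eq_mul]
    calc _ ≤ c i * ((∫⁻ x, φ i x ∂μ) * (η ^ p * ∫⁻ y, φ i y * distDiag y ^ p ∂ν)) := by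
          gcongr
          exact lintegral_prod_withDensity_le hp (hm i) (h i)
      _ ≤ _ := by
          rw [← mul_assoc]
          exact mul_le_of_le_one_left zero_le (hcμ i)
  · exact ENNReal.rpow_le_rpow (edist_proj_le x) hp.le
  · refine ENNReal.rpow_le_rpow ?_ hp.le
    rw [edist_comm]
    exact edist_proj_le x

end Plan

/-! ### Partitions of unity at a scale relative to the diagonal. -/

/-- Near every point of the half-plane, distances are small relative to the distance to the
diagonal. -/
theorem exists_isOpen_edist_le {η : ℝ≥0∞} (hη : η ≠ 0) (z : upperHalf) :
    ∃ U : Set upperHalf, IsOpen U ∧ z ∈ U ∧ ∀ x ∈ U, ∀ y ∈ U, edist x y ≤ η * distDiag y := by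
  obtain ⟨r, hr, hrη⟩ : ∃ r : ℝ≥0∞, 0 < r ∧ r < η * distDiag z :=
    exists_between (pos_iff_ne_zero.2 (mul_ne_zero hη (distDiag_ne_zero z.2)))
  have hlt : r / η < distDiag z := ENNReal.div_lt_of_lt_mul' hrη
  -- The half radius gives diameter at most r, and r < η d(y) on the second set.
  refine ⟨Metric.eball z (r / 2) ∩ {y | r / η < distDiag y}, Metric.isOpen_eball.inter
    (isOpen_lt continuous_const (continuous_distDiag.comp continuous_subtype_val)),
    ⟨Metric.mem_eball_self (ENNReal.half_pos hr.ne'), hlt⟩, fun x hx y hy => ?_⟩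
  have h1 : edist x y ≤ r := by
    refine (edist_triangle_right x y z).trans ?_
    rw [← ENNReal.add_halves r]
    exact add_le_add (Metric.mem_eball.1 hx.1).le (Metric.mem_eball.1 hy.1).le
  refine h1.trans ?_
  rcases eq_or_ne η ∞ with rfl | hη'
  · rw [ENNReal.top_mul (distDiag_ne_zero y.2)]
    exact le_top
  · rw [mul_comm]
    exact (ENNReal.div_le_iff hη hη').1 (le_of_lt hy.2)

theorem exists_partition {η : ℝ≥0∞} (hη : η ≠ 0) {K : Set upperHalf} (hK : IsCompact K) :
    ∃ (s : Finset upperHalf) (φ : s → C_c(upperHalf, ℝ)), (∀ i x, 0 ≤ φ i x) ∧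
      (∀ x, ∑ i, φ i x ≤ 1) ∧ (∀ x ∈ K, ∑ i, φ i x = 1) ∧
      ∀ i x y, φ i x ≠ 0 → φ i y ≠ 0 → edist x y ≤ η * distDiag y := by
  choose U hUo hU hUη using exists_isOpen_edist_le hη
  obtain ⟨s, hs⟩ := hK.elim_finite_subcover U hUo fun x _ => Set.mem_iUnion.2 ⟨x, hU x⟩
  obtain ⟨f, hf, hfc⟩ := PartitionOfUnity.exists_isSubordinate_of_locallyFinite_t2space hK
    (fun i : s => U i) (fun i => hUo i) (locallyFinite_of_finite _) (by
      rwa [Set.iUnion_subtype])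
  refine ⟨s, fun i => ⟨f i, hfc i⟩, fun i x => f.nonneg i x, fun x => ?_, fun x hx => ?_,
    fun i x y hx hy => ?_⟩
  · have := f.sum_le_one x
    rwa [finsum_eq_sum_of_fintype] at this
  · have := f.sum_eq_one hx
    rwa [finsum_eq_sum_of_fintype] at this
  · exact hUη i x (hf i (subset_tsupport _ hx)) y (hf i (subset_tsupport _ hy))

/-- Finite persistence makes d^p μ a finite measure, so inner regularity gives a compact set missing
less than τ of it; the φ_i sum to 1 there. -/
theorem exists_partition_pers_le {p : ℝ} {μ : Measure upperHalf} (hμ : Pers p μ < ∞) {η τ : ℝ≥0∞}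
    (hη : η ≠ 0) (hτ : τ ≠ 0) :
    ∃ (s : Finset upperHalf) (φ : s → C_c(upperHalf, ℝ)), (∀ i x, 0 ≤ φ i x) ∧
      (∀ x, ∑ i, φ i x ≤ 1) ∧
      (∀ i x y, φ i x ≠ 0 → φ i y ≠ 0 → edist x y ≤ η * distDiag y) ∧
      Pers p μ ≤ ∑ i, ∫⁻ x, ENNReal.ofReal (φ i x) * distDiag x ^ p ∂μ + τ := by
  have hd := measurable_distDiag_upperHalf p
  have hfin : IsFiniteMeasure (μ.withDensity fun x => distDiag x ^ p) :=
    isFiniteMeasure_withDensity (by rw [← pers_eq]; exact hμ.ne)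
  obtain ⟨K, -, hK, hKτ⟩ := MeasurableSet.univ.exists_isCompact_sdiff_lt
    (μ := μ.withDensity fun x => distDiag x ^ p) (measure_ne_top _ _) hτ
  obtain ⟨s, φ, h0, h1, hφK, hφ⟩ := exists_partition hη hK
  refine ⟨s, φ, h0, h1, hφ, ?_⟩
  rw [← Set.compl_eq_univ_sdiff, withDensity_apply _ hK.measurableSet.compl] at hKτ
  rw [pers_eq, ← lintegral_add_compl _ hK.measurableSet]
  refine add_le_add ?_ hKτ.le
  have hm (i : s) : Measurable fun x => ENNReal.ofReal (φ i x) * distDiag x ^ p :=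
    (map_continuous (φ i)).measurable.ennreal_ofReal.mul hd
  rw [← lintegral_finsetSum _ fun i _ => hm i]
  refine (setLIntegral_mono_ae' hK.measurableSet (Eventually.of_forall fun x hx => ?_)).trans
    (setLIntegral_le_lintegral K _)
  rw [← Finset.sum_mul, ← ENNReal.ofReal_sum_of_nonneg fun i _ => h0 i x, hφK x hx,
    ENNReal.ofReal_one, one_mul]

/-! ### Passing to the limit, and (i) with (ii) implies convergence in OT. -/

theorem VaguelyTendsto.lintegral {μs : ℕ → Measure upperHalf} {μ : Measure upperHalf}
    (h : VaguelyTendsto μs μ) [IsFiniteMeasureOnCompacts μ]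
    (hμs : ∀ n, IsFiniteMeasureOnCompacts (μs n)) (f : C_c(upperHalf, ℝ)) (hf : ∀ x, 0 ≤ f x) :
    Tendsto (fun n => ∫⁻ x, ENNReal.ofReal (f x) ∂(μs n)) atTop
      (𝓝 (∫⁻ x, ENNReal.ofReal (f x) ∂μ)) := by
  have e (ρ : Measure upperHalf) [IsFiniteMeasureOnCompacts ρ] :
      ∫⁻ x, ENNReal.ofReal (f x) ∂ρ = ENNReal.ofReal (∫ x, f x ∂ρ) :=
    (ofReal_integral_eq_lintegral_ofReal (integrable_of_compactlySupported f)
      (Eventually.of_forall hf)).symm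
  simp_rw [e]
  exact ENNReal.tendsto_ofReal (h f)

theorem lintegral_compactlySupported_ne_top {μ : Measure upperHalf} [IsFiniteMeasureOnCompacts μ]
    (f : C_c(upperHalf, ℝ)) (hf : ∀ x, 0 ≤ f x) : ∫⁻ x, ENNReal.ofReal (f x) ∂μ ≠ ∞ := by
  rw [← ofReal_integral_eq_lintegral_ofReal (integrable_of_compactlySupported f)
      (Eventually.of_forall hf)]
  exact ENNReal.ofReal_ne_top

theorem VaguelyTendsto.lintegral_mul_distDiag {μs : ℕ → Measure upperHalf} {μ : Measure upperHalf}
    (h : VaguelyTendsto μs μ) [IsFiniteMeasureOnCompacts μ]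
    (hμs : ∀ n, IsFiniteMeasureOnCompacts (μs n)) {p : ℝ} (hp : 0 ≤ p) (f : C_c(upperHalf, ℝ))
    (hf : ∀ x, 0 ≤ f x) :
    Tendsto (fun n => ∫⁻ x, ENNReal.ofReal (f x) * distDiag x ^ p ∂(μs n)) atTop
      (𝓝 (∫⁻ x, ENNReal.ofReal (f x) * distDiag x ^ p ∂μ)) := by
  have hc : Continuous fun x : upperHalf => Metric.infDist (x : Plane) diagonal ^ p :=
    ((Metric.continuous_infDist_pt _).comp continuous_subtype_val).rpow_const fun _ => Or.inr hp
  let g : C_c(upperHalf, ℝ) :=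
    ⟨⟨fun x => f x * Metric.infDist (x : Plane) diagonal ^ p, (map_continuous f).mul hc⟩,
      f.hasCompactSupport.mul_right⟩
  have hg (x : upperHalf) : g x = f x * Metric.infDist (x : Plane) diagonal ^ p := rfl
  have e (x : upperHalf) : ENNReal.ofReal (f x) * distDiag x ^ p = ENNReal.ofReal (g x) := by
    rw [hg, ENNReal.ofReal_mul (hf x), distDiag_eq_ofReal,
      ENNReal.ofReal_rpow_of_nonneg Metric.infDist_nonneg hp]
  simp_rw [e]
  exact h.lintegral hμs g fun x =>
    mul_nonneg (hf x) (Real.rpow_nonneg Metric.infDist_nonneg _)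

theorem tendsto_inv_max_mul {u v : ℕ → ℝ≥0∞} {a : ℝ≥0∞} (ha : a ≠ ∞) (ha0 : a ≠ 0)
    (hu : Tendsto u atTop (𝓝 a)) (hv : Tendsto v atTop (𝓝 a)) :
    Tendsto (fun n => (max (u n) a)⁻¹ * v n) atTop (𝓝 1) := by
  have h1 : Tendsto (fun n => (max (u n) a)⁻¹) atTop (𝓝 a⁻¹) := by
    have := (hu.max (tendsto_const_nhds (x := a))).inv
    rwa [max_self] at this
  have h2 := ENNReal.Tendsto.mul h1 (Or.inr ha) hv (Or.inr (ENNReal.inv_ne_top.2 ha0))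
  rwa [ENNReal.inv_mul_cancel ha0 ha] at h2

theorem inv_max_mul_left_le_one (a b : ℝ≥0∞) : (max a b)⁻¹ * a ≤ 1 := by
  rw [mul_comm, ← div_eq_mul_inv]
  exact ENNReal.div_le_of_le_mul (by rw [one_mul]; exact le_max_left a b)

theorem inv_max_mul_right_le_one (a b : ℝ≥0∞) : (max a b)⁻¹ * b ≤ 1 := by
  rw [max_comm]
  exact inv_max_mul_left_le_one b a

theorem lintegral_mul_eq_zero_of_lintegral_eq_zero {μ : Measure upperHalf}
    {f g : upperHalf → ℝ≥0∞} (hf : Measurable f) (h : ∫⁻ x, f x ∂μ = 0) :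
    ∫⁻ x, f x * g x ∂μ = 0 := by
  refine (lintegral_congr_ae ?_).trans lintegral_zero
  filter_upwards [(lintegral_eq_zero_iff hf).1 h] with x hx
  rw [hx, Pi.zero_apply, zero_mul]

/-- Where ∫ φ_i dμ = 0 the coefficients need not converge; being at most 1, they leave a term
dominated by ∫ φ_i d^p dμ_n, which tends to 0. -/
theorem tendsto_pers_leftover {ι : Type*} [Fintype ι] {p : ℝ} {μs : ℕ → Measure upperHalf}
    {μ : Measure upperHalf} {φ : ι → upperHalf → ℝ≥0∞} {s : ℕ → ι → ℝ≥0∞}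
    (hμ : Pers p μ < ∞) (hμs : ∀ n, Pers p (μs n) < ∞)
    (hpers : Tendsto (fun n => Pers p (μs n)) atTop (𝓝 (Pers p μ)))
    (hm : ∀ i, Measurable (φ i)) (hφ : ∀ x, ∑ i, φ i x ≤ 1)
    (hs : ∀ n i, s n i ≤ 1)
    (hlim : ∀ i, Tendsto (fun n => ∫⁻ x, φ i x * distDiag x ^ p ∂(μs n)) atTop
      (𝓝 (∫⁻ x, φ i x * distDiag x ^ p ∂μ)))
    (hs0 : ∀ i, ∫⁻ x, φ i x ∂μ = 0 ∨ Tendsto (fun n => s n i) atTop (𝓝 1)) :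
    Tendsto (fun n => Pers p (leftover (μs n) φ (s n))) atTop
      (𝓝 (Pers p μ - ∑ i, ∫⁻ x, φ i x * distDiag x ^ p ∂μ)) := by
  have hfin (i : ι) : ∫⁻ x, φ i x * distDiag x ^ p ∂μ ≠ ∞ := by
    refine ne_top_of_le_ne_top hμ.ne (lintegral_mono fun x => mul_le_of_le_one_left zero_le ?_)
    exact (Finset.single_le_sum (f := fun i => φ i x) (fun _ _ => zero_le)
      (Finset.mem_univ i)).trans (hφ x)
  have e (n : ℕ) := pers_leftover_eq (hμs n) hm hφ (hs n)
  simp_rw [e]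
  refine ENNReal.Tendsto.sub hpers (tendsto_finsetSum _ fun i _ => ?_) (Or.inl hμ.ne)
  rcases hs0 i with h0 | h1
  · have hz := hlim i
    rw [lintegral_mul_eq_zero_of_lintegral_eq_zero (hm i) h0] at hz ⊢
    exact tendsto_of_tendsto_of_tendsto_of_le_of_le tendsto_const_nhds hz (fun _ => zero_le)
      fun n => mul_le_of_le_one_left zero_le (hs n i)
  · have := ENNReal.Tendsto.mul h1 (Or.inr (hfin i)) (hlim i) (Or.inr ENNReal.one_ne_top)
    rwa [one_mul] at this

theorem eventually_iInf_cost_le {p : ℝ} (hp : 0 < p) {μ : Measure upperHalf}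
    {μs : ℕ → Measure upperHalf} (hμ : μ ∈ MeasuresWithFinitePers p)
    (hμs : ∀ n, μs n ∈ MeasuresWithFinitePers p) (hv : VaguelyTendsto μs μ)
    (hpers : Tendsto (fun n => Pers p (μs n)) atTop (𝓝 (Pers p μ))) {η : ℝ≥0∞} (hη : η ≠ 0)
    (hη' : η ≠ ∞) :
    ∀ᶠ n in atTop, (⨅ (π : Measure (closedHalf × closedHalf)) (_ : IsAdmissible (μs n) μ π),
      cost p π) ≤ η ^ p * Pers p μ + 4 * η := by
  have := hμ.1
  have hfc := fun n => (hμs n).1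
  -- η serves both as relative scale and as lost persistence.
  obtain ⟨ι, f, h0, h1, hη2, hτ⟩ := exists_partition_pers_le hμ.2 hη hη
  let φ (i : ι) (x : upperHalf) : ℝ≥0∞ := ENNReal.ofReal (f i x)
  have hm (i : ι) : Measurable (φ i) := (map_continuous (f i)).measurable.ennreal_ofReal
  have hφ (x : upperHalf) : ∑ i, φ i x ≤ 1 := by
    rw [← ENNReal.ofReal_sum_of_nonneg fun i _ => h0 i x]
    exact ENNReal.ofReal_le_one.2 (h1 x)
  have hne (i : ι) (x : upperHalf) (hx : φ i x ≠ 0) : f i x ≠ 0 := fun h => hx (by simp [φ, h])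
  have ha (i : ι) : Tendsto (fun n => ∫⁻ x, φ i x ∂(μs n)) atTop (𝓝 (∫⁻ x, φ i x ∂μ)) :=
    hv.lintegral hfc (f i) (h0 i)
  have ha' (i : ι) : ∫⁻ x, φ i x ∂μ ≠ ∞ := lintegral_compactlySupported_ne_top (f i) (h0 i)
  -- Dividing by the larger mass keeps both matched fractions at most 1. If both masses vanish then
  -- c is ∞, harmless since ∞ · 0 = 0.
  let c (n : ℕ) (i : ι) : ℝ≥0∞ := (max (∫⁻ x, φ i x ∂(μs n)) (∫⁻ x, φ i x ∂μ))⁻¹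
  have hc1 (n : ℕ) (i : ι) : c n i * ∫⁻ x, φ i x ∂(μs n) ≤ 1 := inv_max_mul_left_le_one _ _
  have hc2 (n : ℕ) (i : ι) : c n i * ∫⁻ x, φ i x ∂μ ≤ 1 := inv_max_mul_right_le_one _ _
  -- The limit is at most η; 2η gives the strict room for an eventual bound on each of the two
  -- remainders, whence 4η.
  have hlt : Pers p μ - ∑ i, ∫⁻ x, φ i x * distDiag x ^ p ∂μ < 2 * η := by
    refine (tsub_le_iff_left.2 hτ).trans_lt ?_
    rw [two_mul]
    exact ENNReal.lt_add_right hη' hη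
  have hl1 := tendsto_pers_leftover (s := fun n i => c n i * ∫⁻ x, φ i x ∂μ) hμ.2
    (fun n => (hμs n).2) hpers hm hφ hc2
    (fun i => hv.lintegral_mul_distDiag hfc hp.le (f i) (h0 i)) fun i => or_iff_not_imp_left.2
      fun hi => tendsto_inv_max_mul (ha' i) hi (ha i) tendsto_const_nhds
  -- For the remainder of μ only the coefficients vary with n.
  have hl2 := tendsto_pers_leftover (μs := fun _ => μ)
    (s := fun n i => c n i * ∫⁻ x, φ i x ∂(μs n)) hμ.2
    (fun _ => hμ.2) tendsto_const_nhds hm hφ hc1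
    (fun i => tendsto_const_nhds) fun i => or_iff_not_imp_left.2
      fun hi => tendsto_inv_max_mul (ha' i) hi (ha i) (ha i)
  have hsum : ∑ i, ∫⁻ x, φ i x * distDiag x ^ p ∂μ ≤ Pers p μ := by
    have h := sum_mul_lintegral_add_leftover (μ := μ) (a := fun _ => 1) hm hφ (fun _ => le_rfl)
      (measurable_distDiag_upperHalf p)
    simp only [one_mul] at h
    rw [pers_eq, ← h]
    exact le_self_add
  filter_upwards [hl1.eventually_lt_const hlt, hl2.eventually_lt_const hlt] with n hn1 hn2
  refine (iInf₂_le _ (isAdmissible_plan hp (hμs n).2 hμ.2 hm hφ (hc1 n) (hc2 n))).trans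
    ((cost_plan_le hp hm (fun i x y hx hy => hη2 i x y (hne i x hx) (hne i y hy)) (hc1 n)).trans ?_)
  calc _ ≤ η ^ p * Pers p μ + 2 * η + 2 * η := by gcongr
    _ = η ^ p * Pers p μ + 4 * η := by ring

theorem tendsto_OT {p : ℝ} (hp : 0 < p) {μ : Measure upperHalf}
    {μs : ℕ → Measure upperHalf} (hμ : μ ∈ MeasuresWithFinitePers p)
    (hμs : ∀ n, μs n ∈ MeasuresWithFinitePers p) (hv : VaguelyTendsto μs μ)
    (hpers : Tendsto (fun n => Pers p (μs n)) atTop (𝓝 (Pers p μ))) :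
    Tendsto (fun n => OT p (μs n) μ) atTop (𝓝 0) := by
  have hI : Tendsto (fun n => ⨅ (π : Measure (closedHalf × closedHalf))
      (_ : IsAdmissible (μs n) μ π), cost p π) atTop (𝓝 0) := by
    rw [ENNReal.tendsto_nhds_zero]
    intro ε hε
    have hη : Tendsto (fun k : ℕ => ((k : ℝ≥0∞)⁻¹) ^ p * Pers p μ + 4 * (k : ℝ≥0∞)⁻¹) atTop
        (𝓝 (0 ^ p * Pers p μ + 4 * 0)) :=
      (ENNReal.Tendsto.mul_const (ENNReal.tendsto_inv_nat_nhds_zero.ennrpow_const p)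
        (Or.inr hμ.2.ne)).add
        (ENNReal.Tendsto.const_mul ENNReal.tendsto_inv_nat_nhds_zero (Or.inr (by simp)))
    rw [ENNReal.zero_rpow_of_pos hp, zero_mul, mul_zero, add_zero] at hη
    obtain ⟨k, hk, hk0⟩ := ((hη.eventually_lt_const hε).and (eventually_gt_atTop 0)).exists
    filter_upwards [eventually_iInf_cost_le hp hμ hμs hv hpers (η := (k : ℝ≥0∞)⁻¹) (by simp)
      (by simpa using hk0.ne')] with n hn
    exact hn.trans hk.le
  have := hI.ennrpow_const (1 / p)
  rwa [ENNReal.zero_rpow_of_pos (by positivity)] at this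

end PersistenceMeasure

theorem mainTheorem1 (p : ℝ) (hp : 1 ≤ p)
    (μ : MeasureTheory.Measure PersistenceMeasure.upperHalf)
    (μs : ℕ → MeasureTheory.Measure PersistenceMeasure.upperHalf)
    (hμ : μ ∈ PersistenceMeasure.MeasuresWithFinitePers p)
    (hμs : ∀ n, μs n ∈ PersistenceMeasure.MeasuresWithFinitePers p) :
    Tendsto (fun n => PersistenceMeasure.OT p (μs n) μ) atTop (𝓝 0) ↔
      PersistenceMeasure.VaguelyTendsto μs μ ∧
        Tendsto (fun n => PersistenceMeasure.Pers p (μs n)) atTop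
          (𝓝 (PersistenceMeasure.Pers p μ)) :=
  ⟨fun h => ⟨PersistenceMeasure.vaguelyTendsto_of_tendsto_OT hp hμ hμs h,
    PersistenceMeasure.tendsto_pers_of_tendsto_OT hp hμ h⟩,
    fun h => PersistenceMeasure.tendsto_OT (zero_lt_one.trans_le hp) hμ hμs h.1 h.2⟩
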